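/- A graph function is a Borel function $g:[0,1]^2\to[0,1]$ with $g(x,y)=g(y,x)$ almost everywhere. A graphon is an equivalence class $\gamma=[g]$ of graph functions for the relation $\delta_\square(g_1,g_2)=0$, where $$\delta_\square(g_1,g_2)=\inf_\sigma\ \sup_{S,T\subset[0,1]\text{ measurable}}\left|\int_{S\times T}\big(g_1(\sigma(x),\sigma(y))-g_2(x,y)\big)\,dx\,dy\right|$$ and $\sigma$ runs over the measure-preserving measurable bijections of $[0,1]$. For a finite simple graph $F$ on $\{1,\dots,k\}$, put $t(F,\gamma)=\int_{[0,1]^k}\prod_{\{i,j\}\in E_F}g(x_i,x_j)\,dx_1\cdots dx_k$ (this does not depend on the representative $g$). The edge density of $\gamma$ is $p=\iint g(x,y)\,dx\,dy$. The graphon $\gamma$ is called singular if for all non-empty finite graphs $F_1,F_2$ with $k_1,k_2$ vertices, $$t(F_1\sqcup F_2,\gamma)=\frac1{k_1k_2}\sum_{i_1=1}^{k_1}\sum_{i_2=1}^{k_2}t\big((F_1\bowtie F_2)(i_1,i_2),\gamma\big),$$ where $(F_1\bowtie F_2)(i_1,i_2)$ is obtained from the disjoint union $F_1\sqcup F_2$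 by identifying the vertex $i_1$ of $F_1$ with the vertex $i_2$ of $F_2$. For $n\ge1$, the $W$-random graph $G_n(\gamma)$ has vertex set $\{1,\dots,n\}$ and, for $i<j$, an edge between $i$ and $j$ if and only if $U_{ij}\le g(X_i,X_j)$, where the $X_i$ and the $U_{ij}$ ($i<j$) are independent and uniform on $[0,1]$ and $g$ is any representative of $\gamma$. **Proposition.** Let $\gamma$ be a singular graphon with edge density $p$, let $n\ge1$, let $\varepsilon_1,\dots,\varepsilon_n$ be real numbers and $z\in\mathbb C$. Let $L_n(\gamma)=D-A$ be the Laplacian matrix (degree matrix minus adjacency matrix) of $G_n(\gamma)$. Then the random variable $\det\big((1+pz)I_n+z\,\mathrm{diag}(\varepsilon_1,\dots,\varepsilon_n)-\tfrac zn L_n(\gamma)\big)$ is integrable and $$\mathbb E\left[\det\Big((1+pz)I_n+z\,\mathrm{diag}(\varepsilon_1,\dots,\varepsilon_n)-\frac zn L_n(\gamma)\Big)\right]=\frac1n\sum_{i=1}^n(1+pz+\varepsilon_iz)\prod_{j\ne i}(1+\varepsilon_jz).$$ In particular, if $1+\varepsilon_iz\neq0$ for every $i$, this expectation is equal to $$\left(\prod_{i=1}^n(1+\varepsilon_iz)\right)\left(\frac1n\sum_{i=1}^n\frac{1+pz+\varepsilon_iz}{1+\varepsilon_iz}\right).$$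 -/

import Mathlib

open MeasureTheory ProbabilityTheory
open scoped unitInterval

noncomputable section

/-! ### Graph functions, the cut metric and graphons -/

/-- A graph function: a Borel function `[0,1]² → [0,1]`, symmetric almost everywhere. -/
structure GraphFunction where
  toFun : I → I → ℝ
  measurable_toFun : Measurable (fun q : I × I => toFun q.1 q.2)
  nonneg : ∀ x y, 0 ≤ toFun x y
  le_one : ∀ x y, toFun x y ≤ 1
  symm_ae : ∀ᵐ q : I × I, toFun q.1 q.2 = toFun q.2 q.1

/-- A Lebesgue isomorphism of `[0,1]`: a bijective bimeasurable map preserving Lebesgue measure.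
(The inverse of a bijective Borel map of `[0,1]` is automatically Borel.) -/
def LebesgueIso : Type :=
  {τ : I ≃ᵐ I // MeasurePreserving τ (volume : Measure I) (volume : Measure I)}

/-- The cut norm `sup_{S,T} |∫_{S × T} w|`, over pairs of measurable subsets of `[0,1]`. -/
def cutNorm (w : I → I → ℝ) : ℝ :=
  ⨆ S : {S : Set I // MeasurableSet S}, ⨆ T : {T : Set I // MeasurableSet T},
    |∫ q in S.1 ×ˢ T.1, w q.1 q.2|

/-- The cut metric `inf_τ ‖g₁^τ - g₂‖`, over the Lebesgue isomorphisms `τ`. -/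
def cutDist (g₁ g₂ : GraphFunction) : ℝ :=
  ⨅ τ : LebesgueIso, cutNorm (fun x y => g₁.toFun (τ.1 x) (τ.1 y) - g₂.toFun x y)

/-- Graphons: graph functions modulo the (equivalence) relation `cutDist g₁ g₂ = 0`. -/
def Graphon : Type := Quot (fun g₁ g₂ : GraphFunction => cutDist g₁ g₂ = 0)

/-- The graphon `[g]` of a graph function `g`. -/
def Graphon.mk (g : GraphFunction) : Graphon := Quot.mk _ g

/-! ### Homomorphism densities -/

open Classical in
/-- The edges of a graph on `{0, …, k-1}`, each listed once, as a pair `(i, j)` with `i < j`. -/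
def edgePairs {k : ℕ} (F : SimpleGraph (Fin k)) : Finset (Fin k × Fin k) :=
  Finset.univ.filter (fun e => e.1 < e.2 ∧ F.Adj e.1 e.2)

/-- `∫_{[0,1]^k} ∏_{{i,j} ∈ E_F} g(x_i, x_j) dx_1 ⋯ dx_k`. -/
def GraphFunction.homDensity (g : GraphFunction) {k : ℕ} (F : SimpleGraph (Fin k)) : ℝ :=
  ∫ x : Fin k → I, ∏ e ∈ edgePairs F, g.toFun (x e.1) (x e.2)

/-! The next facts show that the densities only depend on the graphon `[g]`. -/

theorem cutNorm_integrable {w : I → I → ℝ} (hw : Measurable (fun q : I × I => w q.1 q.2))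
    (hb : ∀ x y, |w x y| ≤ 1) : Integrable (fun q : I × I => w q.1 q.2) :=
  Integrable.of_bound hw.aestronglyMeasurable 1 (Filter.Eventually.of_forall fun q => hb q.1 q.2)

theorem abs_setIntegral_le_cutNorm {w : I → I → ℝ} (hb : ∀ x y, |w x y| ≤ 1)
    {S T : Set I} (hS : MeasurableSet S) (hT : MeasurableSet T) :
    |∫ q in S ×ˢ T, w q.1 q.2| ≤ cutNorm w := by
  have key : ∀ S T : Set I, |∫ q in S ×ˢ T, w q.1 q.2| ≤ 1 := by
    intro S T
    have h := norm_setIntegral_le_of_norm_le_const (μ := (volume : Measure (I × I)))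
      (s := S ×ˢ T) (f := fun q : I × I => w q.1 q.2) (C := 1) (measure_lt_top _ _)
      (fun q _ => hb q.1 q.2)
    rw [Real.norm_eq_abs] at h
    refine h.trans ?_
    rw [one_mul]
    exact measureReal_le_one
  have b1 : ∀ S : {S : Set I // MeasurableSet S}, BddAbove (Set.range
      fun T : {T : Set I // MeasurableSet T} => |∫ q in S.1 ×ˢ T.1, w q.1 q.2|) := by
    intro S
    refine ⟨1, ?_⟩
    rintro _ ⟨T, rfl⟩
    exact key _ _
  have : Nonempty {T : Set I // MeasurableSet T} := ⟨⟨∅, MeasurableSet.empty⟩⟩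
  have b2 : BddAbove (Set.range fun S : {S : Set I // MeasurableSet S} =>
      ⨆ T : {T : Set I // MeasurableSet T}, |∫ q in S.1 ×ˢ T.1, w q.1 q.2|) := by
    refine ⟨1, ?_⟩
    rintro _ ⟨S, rfl⟩
    exact ciSup_le fun T => key _ _
  exact (le_ciSup (b1 ⟨S, hS⟩) ⟨T, hT⟩).trans (le_ciSup b2 ⟨S, hS⟩)

theorem exists_set_abs_integral_le {φ a : I → ℝ} (hφ : Integrable φ) (hφm : Measurable φ)
    (ha : Measurable a) (h0 : ∀ x, 0 ≤ a x) (h1 : ∀ x, a x ≤ 1) :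
    ∃ S : Set I, MeasurableSet S ∧ |∫ x, φ x * a x| ≤ |∫ x in S, φ x| := by
  have hP : MeasurableSet {x | 0 ≤ φ x} := measurableSet_le measurable_const hφm
  have hN : MeasurableSet {x | φ x ≤ 0} := measurableSet_le hφm measurable_const
  have hi : Integrable (fun x => φ x * a x) :=
    hφ.mul_bdd (c := 1) ha.aestronglyMeasurable
      (Filter.Eventually.of_forall fun x => by rw [Real.norm_of_nonneg (h0 x)]; exact h1 x)
  have up : ∫ x, φ x * a x ≤ ∫ x in {x | 0 ≤ φ x}, φ x := by
    rw [← integral_indicator hP]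
    refine integral_mono hi (hφ.indicator hP) fun x => ?_
    by_cases hx : 0 ≤ φ x
    · simp only [Set.indicator, Set.mem_ofPred_eq, hx, if_true]
      nlinarith [h1 x]
    · simp only [Set.indicator, Set.mem_ofPred_eq, hx, if_false]
      nlinarith [h0 x]
  have lo : ∫ x in {x | φ x ≤ 0}, φ x ≤ ∫ x, φ x * a x := by
    rw [← integral_indicator hN]
    refine integral_mono (hφ.indicator hN) hi fun x => ?_
    by_cases hx : φ x ≤ 0
    · simp only [Set.indicator, Set.mem_ofPred_eq, hx, if_true]
      nlinarith [h1 x]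
    · simp only [Set.indicator, Set.mem_ofPred_eq, hx, if_false]
      nlinarith [h0 x]
  rcases le_total 0 (∫ x, φ x * a x) with h | h
  · exact ⟨_, hP, by rw [abs_of_nonneg h]; exact up.trans (le_abs_self _)⟩
  · exact ⟨_, hN, by rw [abs_of_nonpos h]; exact (neg_le_neg lo).trans (neg_le_abs _)⟩

theorem abs_integral_mul_le_cutNorm {w : I → I → ℝ}
    (hw : Measurable (fun q : I × I => w q.1 q.2)) (hb : ∀ x y, |w x y| ≤ 1)
    {a b : I → ℝ} (ha : Measurable a) (hb' : Measurable b)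
    (ha0 : ∀ x, 0 ≤ a x) (ha1 : ∀ x, a x ≤ 1) (hb0 : ∀ x, 0 ≤ b x) (hb1 : ∀ x, b x ≤ 1) :
    |∫ x, ∫ y, w x y * (a x * b y)| ≤ cutNorm w := by
  have hwi := cutNorm_integrable hw hb
  have hwb : Integrable (fun q : I × I => w q.1 q.2 * b q.2) :=
    hwi.mul_bdd (c := 1) (hb'.comp measurable_snd).aestronglyMeasurable
      (Filter.Eventually.of_forall fun q => by
        rw [Real.norm_of_nonneg (hb0 _)]; exact hb1 _)
  have hwbm : Measurable (fun q : I × I => w q.1 q.2 * b q.2) :=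
    hw.mul (hb'.comp measurable_snd)
  obtain ⟨S, hS, h1⟩ := exists_set_abs_integral_le (φ := fun x => ∫ y, w x y * b y)
    hwb.integral_prod_left
    (hwbm.stronglyMeasurable.integral_prod_right).measurable ha ha0 ha1
  have e1 : ∫ x, ∫ y, w x y * (a x * b y) = ∫ x, (∫ y, w x y * b y) * a x := by
    refine integral_congr_ae (Filter.Eventually.of_forall fun x => ?_)
    simp only
    rw [← integral_mul_const]
    refine integral_congr_ae (Filter.Eventually.of_forall fun y => ?_)
    simp only
    ring
  have hwS : Integrable (fun q : I × I => w q.1 q.2)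
      (((volume : Measure I).restrict S).prod (volume : Measure I)) := by
    have := hwi.restrict (s := S ×ˢ Set.univ)
    rwa [Measure.volume_eq_prod, ← Measure.prod_restrict, Measure.restrict_univ] at this
  have hwbS : Integrable (fun q : I × I => w q.1 q.2 * b q.2)
      (((volume : Measure I).restrict S).prod (volume : Measure I)) := by
    have := hwb.restrict (s := S ×ˢ Set.univ)
    rwa [Measure.volume_eq_prod, ← Measure.prod_restrict, Measure.restrict_univ] at this
  have hsw : Measurable (fun q : I × I => w q.2 q.1) := hw.comp measurable_swap
  obtain ⟨T, hT, h2⟩ := exists_set_abs_integral_le (φ := fun y => ∫ x in S, w x y)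
    hwS.integral_prod_right
    (hsw.stronglyMeasurable.integral_prod_right (ν := (volume : Measure I).restrict S)).measurable
    hb' hb0 hb1
  have e2 : ∫ x in S, ∫ y, w x y * b y = ∫ y, (∫ x in S, w x y) * b y := by
    rw [integral_integral_swap hwbS]
    refine integral_congr_ae (Filter.Eventually.of_forall fun y => ?_)
    simp only
    rw [integral_mul_const]
  have e3 : ∫ y in T, ∫ x in S, w x y = ∫ q in S ×ˢ T, w q.1 q.2 := by
    have hST : Integrable (fun q : I × I => w q.1 q.2)
        (((volume : Measure I).restrict S).prod ((volume : Measure I).restrict T)) := by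
      have := hwi.restrict (s := S ×ˢ T)
      rwa [Measure.volume_eq_prod, ← Measure.prod_restrict] at this
    rw [← integral_integral_swap hST, Measure.volume_eq_prod, ← Measure.prod_restrict,
      integral_prod _ hST]
  rw [e1]
  refine h1.trans ?_
  rw [e2]
  refine h2.trans ?_
  rw [e3]
  exact abs_setIntegral_le_cutNorm hb hS hT

theorem measurePreserving_update {k : ℕ} (i : Fin k) :
    MeasurePreserving (fun q : (Fin k → I) × I => Function.update q.1 i q.2)
      ((volume : Measure (Fin k → I)).prod (volume : Measure I)) volume := by
  have hm : Measurable (fun q : (Fin k → I) × I => Function.update q.1 i q.2) := by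
    rw [measurable_pi_iff]
    intro j
    by_cases h : j = i
    · subst h; simpa using measurable_snd
    · simp only [Function.update_of_ne h]; fun_prop
  refine ⟨hm, ?_⟩
  rw [volume_pi]
  symm
  refine Measure.pi_eq fun s hs => ?_
  rw [Measure.map_apply hm (MeasurableSet.univ_pi hs)]
  have : (fun q : (Fin k → I) × I => Function.update q.1 i q.2) ⁻¹' (Set.univ.pi s)
      = (Set.univ.pi (Function.update s i Set.univ)) ×ˢ (s i) := by
    ext q
    simp only [Set.mem_preimage, Set.mem_pi, Set.mem_univ, true_implies, Set.mem_prod]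
    constructor
    · intro h
      refine ⟨fun j => ?_, by simpa using h i⟩
      by_cases hj : j = i
      · subst hj; simp
      · simpa [Function.update_of_ne hj] using h j
    · rintro ⟨h, h'⟩ j
      by_cases hj : j = i
      · subst hj; simpa using h'
      · simpa [Function.update_of_ne hj] using h j
  rw [this, Measure.prod_prod, Measure.pi_pi,
    ← Finset.mul_prod_erase Finset.univ (fun j => volume (s j)) (Finset.mem_univ i), mul_comm,
    ← Finset.mul_prod_erase Finset.univ _ (Finset.mem_univ i)]
  simp only [Function.update_self, measure_univ, one_mul]
  congr 1
  refine Finset.prod_congr rfl fun j hj => ?_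
  rw [Function.update_of_ne (Finset.ne_of_mem_erase hj)]

theorem integral_update {k : ℕ} (i : Fin k) {f : (Fin k → I) → ℝ} (hf : Measurable f)
    {C : ℝ} (hC : ∀ x, |f x| ≤ C) :
    ∫ x, f x = ∫ x : Fin k → I, ∫ u : I, f (Function.update x i u) := by
  have mp := measurePreserving_update i
  have h := integral_map (μ := (volume : Measure (Fin k → I)).prod (volume : Measure I))
    mp.measurable.aemeasurable (f := f) hf.aestronglyMeasurable
  rw [mp.map_eq] at h
  rw [h]
  refine integral_prod (fun q : (Fin k → I) × I => f (Function.update q.1 i q.2)) ?_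
  exact Integrable.of_bound (hf.comp mp.measurable).aestronglyMeasurable C
    (Filter.Eventually.of_forall fun q => hC _)

theorem abs_integral_factor_le {k : ℕ} {i j : Fin k} (hij : i ≠ j) {w : I → I → ℝ}
    (hw : Measurable (fun q : I × I => w q.1 q.2)) (hb : ∀ x y, |w x y| ≤ 1)
    {A B : (Fin k → I) → ℝ} (hA : Measurable A) (hB : Measurable B)
    (hA0 : ∀ x, 0 ≤ A x) (hA1 : ∀ x, A x ≤ 1) (hB0 : ∀ x, 0 ≤ B x) (hB1 : ∀ x, B x ≤ 1)
    (hAj : ∀ x v, A (Function.update x j v) = A x)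
    (hBi : ∀ x u, B (Function.update x i u) = B x) :
    |∫ x, w (x i) (x j) * (A x * B x)| ≤ cutNorm w := by
  have hw' : Measurable (fun x : Fin k → I => w (x i) (x j)) :=
    hw.comp (g := fun q : I × I => w q.1 q.2) (f := fun x : Fin k → I => (x i, x j))
      ((measurable_pi_apply i).prodMk (measurable_pi_apply j))
  have hm : Measurable (fun x : Fin k → I => w (x i) (x j) * (A x * B x)) :=
    hw'.mul (hA.mul hB)
  have hbd : ∀ x : Fin k → I, |w (x i) (x j) * (A x * B x)| ≤ 1 := by
    intro x
    rw [abs_mul, abs_mul, abs_of_nonneg (hA0 x), abs_of_nonneg (hB0 x)]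
    exact mul_le_one₀ (hb _ _) (mul_nonneg (hA0 x) (hB0 x))
      (mul_le_one₀ (hA1 x) (hB0 x) (hB1 x))
  have mu : ∀ (l : Fin k) (x : Fin k → I), Measurable (fun u : I => Function.update x l u) :=
    fun l x => measurable_update x
  have e : ∀ x : Fin k → I,
      ∫ u : I, ∫ v : I, (fun x : Fin k → I => w (x i) (x j) * (A x * B x))
        (Function.update (Function.update x i u) j v)
      = ∫ u : I, ∫ v : I, w u v *
        (A (Function.update x i u) * B (Function.update x j v)) := by
    intro x
    refine integral_congr_ae (Filter.Eventually.of_forall fun u => ?_)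
    refine integral_congr_ae (Filter.Eventually.of_forall fun v => ?_)
    simp only [Function.update_self, Function.update_of_ne hij, hAj]
    rw [Function.update_comm hij, hBi]
  have e0 : ∫ x : Fin k → I, w (x i) (x j) * (A x * B x)
      = ∫ x : Fin k → I, ∫ u : I, ∫ v : I, w u v *
        (A (Function.update x i u) * B (Function.update x j v)) := by
    rw [integral_update j hm hbd]
    have mp := measurePreserving_update j
    have hm2 : Measurable (fun x : Fin k → I => ∫ v : I,
        (fun x : Fin k → I => w (x i) (x j) * (A x * B x)) (Function.update x j v)) := by
      have h3 : StronglyMeasurable (Function.uncurry fun (x : Fin k → I) (v : I) =>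
          (fun x : Fin k → I => w (x i) (x j) * (A x * B x)) (Function.update x j v)) :=
        (hm.comp mp.measurable).stronglyMeasurable
      exact (h3.integral_prod_right (ν := (volume : Measure I))).measurable
    rw [integral_update i hm2 (C := 1)]
    · exact integral_congr_ae (Filter.Eventually.of_forall fun x => e x)
    · intro x
      have := norm_integral_le_of_norm_le_const (μ := (volume : Measure I))
        (f := fun v : I => (fun x : Fin k → I => w (x i) (x j) * (A x * B x))
          (Function.update x j v)) (C := 1) (Filter.Eventually.of_forall fun v => hbd _)
      simpa using this
  rw [e0]
  have := norm_integral_le_of_norm_le_const (μ := (volume : Measure (Fin k → I)))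
    (f := fun x : Fin k → I => ∫ u : I, ∫ v : I, w u v *
        (A (Function.update x i u) * B (Function.update x j v))) (C := cutNorm w)
    (Filter.Eventually.of_forall fun x => by
      rw [Real.norm_eq_abs]
      exact abs_integral_mul_le_cutNorm hw hb (hA.comp (mu i x)) (hB.comp (mu j x))
        (fun _ => hA0 _) (fun _ => hA1 _) (fun _ => hB0 _) (fun _ => hB1 _))
  simpa using this

theorem measurable_prod_pairs {k : ℕ} (D : Finset (Fin k × Fin k))
    (h : Fin k × Fin k → GraphFunction) :
    Measurable (fun x : Fin k → I => ∏ e ∈ D, (h e).toFun (x e.1) (x e.2)) :=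
  Finset.measurable_prod _ fun e _ => (h e).measurable_toFun.comp
    (g := fun q : I × I => (h e).toFun q.1 q.2) (f := fun x : Fin k → I => (x e.1, x e.2))
    ((measurable_pi_apply e.1).prodMk (measurable_pi_apply e.2))

theorem prod_pairs_nonneg {k : ℕ} (D : Finset (Fin k × Fin k))
    (h : Fin k × Fin k → GraphFunction) (x : Fin k → I) :
    0 ≤ ∏ e ∈ D, (h e).toFun (x e.1) (x e.2) :=
  Finset.prod_nonneg fun e _ => (h e).nonneg _ _

theorem prod_pairs_le_one {k : ℕ} (D : Finset (Fin k × Fin k))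
    (h : Fin k × Fin k → GraphFunction) (x : Fin k → I) :
    ∏ e ∈ D, (h e).toFun (x e.1) (x e.2) ≤ 1 :=
  Finset.prod_le_one (fun e _ => (h e).nonneg _ _) fun e _ => (h e).le_one _ _

theorem abs_integral_replace_le {k : ℕ} (g₁ g₂ : GraphFunction)
    (h : Fin k × Fin k → GraphFunction) (e : Fin k × Fin k) (he : e.1 < e.2)
    (D : Finset (Fin k × Fin k)) (hD : ∀ f ∈ D, f.1 < f.2) (heD : e ∉ D) :
    |∫ x : Fin k → I, (g₁.toFun (x e.1) (x e.2) - g₂.toFun (x e.1) (x e.2)) *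
      ∏ f ∈ D, (h f).toFun (x f.1) (x f.2)|
      ≤ cutNorm (fun x y => g₁.toFun x y - g₂.toFun x y) := by
  classical
  have split : ∀ x : Fin k → I, ∏ f ∈ D, (h f).toFun (x f.1) (x f.2)
      = (∏ f ∈ D.filter (fun f => f.1 = e.1 ∨ f.2 = e.1), (h f).toFun (x f.1) (x f.2)) *
        ∏ f ∈ D.filter (fun f => ¬ (f.1 = e.1 ∨ f.2 = e.1)), (h f).toFun (x f.1) (x f.2) :=
    fun x => (Finset.prod_filter_mul_prod_filter_not _ _ _).symm
  simp only [split]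
  refine abs_integral_factor_le (w := fun x y => g₁.toFun x y - g₂.toFun x y) he.ne
    (g₁.measurable_toFun.sub g₂.measurable_toFun) ?_
    (measurable_prod_pairs _ h) (measurable_prod_pairs _ h)
    (prod_pairs_nonneg _ h) (prod_pairs_le_one _ h)
    (prod_pairs_nonneg _ h) (prod_pairs_le_one _ h) ?_ ?_
  · intro x y
    rw [abs_le]
    constructor <;>
      linarith [g₁.nonneg x y, g₁.le_one x y, g₂.nonneg x y, g₂.le_one x y]
  · intro x v
    refine Finset.prod_congr rfl fun f hf => ?_
    rw [Finset.mem_filter] at hf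
    have hf' := hD f hf.1
    have n1 : f.1 ≠ e.2 := by
      intro h1
      rcases hf.2 with h2 | h2
      · exact he.ne (h2.symm.trans h1)
      · rw [h1, h2] at hf'; exact lt_asymm he hf'
    have n2 : f.2 ≠ e.2 := by
      intro h1
      rcases hf.2 with h2 | h2
      · exact heD ((Prod.ext h2 h1 : f = e) ▸ hf.1)
      · exact he.ne (h2.symm.trans h1)
    rw [Function.update_of_ne n1, Function.update_of_ne n2]
  · intro x u
    refine Finset.prod_congr rfl fun f hf => ?_
    rw [Finset.mem_filter, not_or] at hf
    rw [Function.update_of_ne hf.2.1, Function.update_of_ne hf.2.2]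

theorem abs_integral_prod_sub_le {k : ℕ} (g₁ g₂ : GraphFunction)
    (E : Finset (Fin k × Fin k)) : ∀ D : Finset (Fin k × Fin k), (∀ f ∈ E, f.1 < f.2) →
    (∀ f ∈ D, f.1 < f.2) → Disjoint E D →
    |(∫ x : Fin k → I, (∏ f ∈ E, g₁.toFun (x f.1) (x f.2)) *
        ∏ f ∈ D, g₂.toFun (x f.1) (x f.2)) -
      ∫ x : Fin k → I, (∏ f ∈ E, g₂.toFun (x f.1) (x f.2)) *
        ∏ f ∈ D, g₂.toFun (x f.1) (x f.2)|
      ≤ E.card * cutNorm (fun x y => g₁.toFun x y - g₂.toFun x y) := by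
  classical
  have int : ∀ (E D : Finset (Fin k × Fin k)) (g g' : GraphFunction), Integrable
      (fun x : Fin k → I => (∏ f ∈ E, g.toFun (x f.1) (x f.2)) *
        ∏ f ∈ D, g'.toFun (x f.1) (x f.2)) := by
    intro E D g g'
    refine Integrable.of_bound ((measurable_prod_pairs E fun _ => g).mul
      (measurable_prod_pairs D fun _ => g')).aestronglyMeasurable 1
      (Filter.Eventually.of_forall fun x => ?_)
    have a0 := prod_pairs_nonneg E (fun _ => g) x
    have a1 := prod_pairs_le_one E (fun _ => g) x
    have b0 := prod_pairs_nonneg D (fun _ => g') x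
    have b1 := prod_pairs_le_one D (fun _ => g') x
    rw [Real.norm_of_nonneg (mul_nonneg a0 b0)]
    exact mul_le_one₀ a1 b0 b1
  induction E using Finset.induction_on with
  | empty => intro D _ _ _; simp
  | insert e E heE ih =>
    intro D hE hD hdis
    have he : e.1 < e.2 := hE e (Finset.mem_insert_self _ _)
    have hE' : ∀ f ∈ E, f.1 < f.2 := fun f hf => hE f (Finset.mem_insert_of_mem hf)
    rw [Finset.disjoint_insert_left] at hdis
    have step := abs_integral_replace_le g₁ g₂ (fun f => if f ∈ E then g₁ else g₂) e he (E ∪ D)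
      (fun f hf => (Finset.mem_union.1 hf).elim (hE' f) (hD f))
      (by rw [Finset.mem_union, not_or]; exact ⟨heE, hdis.1⟩)
    have ih' := ih (insert e D) hE'
      (fun f hf => (Finset.mem_insert.1 hf).elim (fun h => h ▸ he) (hD f))
      (Finset.disjoint_insert_right.2 ⟨heE, hdis.2⟩)
    have s1 : ∀ x : Fin k → I,
        (g₁.toFun (x e.1) (x e.2) - g₂.toFun (x e.1) (x e.2)) *
          ∏ f ∈ E ∪ D, (if f ∈ E then g₁ else g₂).toFun (x f.1) (x f.2)
        = (∏ f ∈ insert e E, g₁.toFun (x f.1) (x f.2)) *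
            (∏ f ∈ D, g₂.toFun (x f.1) (x f.2)) -
          (∏ f ∈ E, g₁.toFun (x f.1) (x f.2)) *
            ∏ f ∈ insert e D, g₂.toFun (x f.1) (x f.2) := by
      intro x
      rw [Finset.prod_union hdis.2, Finset.prod_insert heE, Finset.prod_insert hdis.1]
      have p1 : ∏ f ∈ E, (if f ∈ E then g₁ else g₂).toFun (x f.1) (x f.2)
          = ∏ f ∈ E, g₁.toFun (x f.1) (x f.2) :=
        Finset.prod_congr rfl fun f hf => by rw [if_pos hf]
      have p2 : ∏ f ∈ D, (if f ∈ E then g₁ else g₂).toFun (x f.1) (x f.2)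
          = ∏ f ∈ D, g₂.toFun (x f.1) (x f.2) :=
        Finset.prod_congr rfl fun f hf => by
          rw [if_neg (Finset.disjoint_right.1 hdis.2 hf)]
      rw [p1, p2]
      ring
    simp only [s1] at step
    rw [integral_sub (int _ _ _ _) (int _ _ _ _)] at step
    have s2 : ∫ x : Fin k → I, (∏ f ∈ E, g₂.toFun (x f.1) (x f.2)) *
          ∏ f ∈ insert e D, g₂.toFun (x f.1) (x f.2)
        = ∫ x : Fin k → I, (∏ f ∈ insert e E, g₂.toFun (x f.1) (x f.2)) *
          ∏ f ∈ D, g₂.toFun (x f.1) (x f.2) := by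
      refine integral_congr_ae (Filter.Eventually.of_forall fun x => ?_)
      simp only
      rw [Finset.prod_insert heE, Finset.prod_insert hdis.1]
      ring
    rw [s2] at ih'
    rw [Finset.card_insert_of_notMem heE]
    push_cast
    refine (abs_sub_le _ _ _).trans ((add_le_add step ih').trans (le_of_eq ?_))
    ring

theorem GraphFunction.abs_homDensity_sub_le (g₁ g₂ : GraphFunction) {k : ℕ}
    (F : SimpleGraph (Fin k)) :
    |g₁.homDensity F - g₂.homDensity F|
      ≤ (edgePairs F).card * cutNorm (fun x y => g₁.toFun x y - g₂.toFun x y) := by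
  have h := abs_integral_prod_sub_le g₁ g₂ (edgePairs F) ∅
    (fun f hf => by classical exact (Finset.mem_filter.1 hf).2.1) (fun f hf => absurd hf (Finset.notMem_empty f))
    (Finset.disjoint_empty_right _)
  simpa [GraphFunction.homDensity] using h

/-- The graph function `g^τ(x, y) = g(τ(x), τ(y))`. -/
def GraphFunction.precomp (g : GraphFunction) (τ : LebesgueIso) : GraphFunction where
  toFun x y := g.toFun (τ.1 x) (τ.1 y)
  measurable_toFun := g.measurable_toFun.comp
    ((τ.1.measurable.comp measurable_fst).prodMk (τ.1.measurable.comp measurable_snd))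
  nonneg _ _ := g.nonneg _ _
  le_one _ _ := g.le_one _ _
  symm_ae := (τ.2.prod τ.2).quasiMeasurePreserving.ae g.symm_ae

theorem GraphFunction.homDensity_precomp (g : GraphFunction) (τ : LebesgueIso) {k : ℕ}
    (F : SimpleGraph (Fin k)) : (g.precomp τ).homDensity F = g.homDensity F := by
  have mp : MeasurePreserving (fun (x : Fin k → I) (i : Fin k) => τ.1 (x i))
      (volume : Measure (Fin k → I)) volume :=
    volume_preserving_pi (fun _ => τ.2)
  have h := integral_map (μ := (volume : Measure (Fin k → I))) mp.measurable.aemeasurable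
    (measurable_prod_pairs (edgePairs F) fun _ => g).aestronglyMeasurable
  rw [mp.map_eq] at h
  exact h.symm

theorem GraphFunction.homDensity_eq_of_cutDist (g₁ g₂ : GraphFunction)
    (h : cutDist g₁ g₂ = 0) {k : ℕ} (F : SimpleGraph (Fin k)) :
    g₁.homDensity F = g₂.homDensity F := by
  have : Nonempty LebesgueIso := ⟨⟨MeasurableEquiv.refl I, MeasurePreserving.id _⟩⟩
  refine eq_of_abs_sub_le_all fun ε hε => ?_
  have hpos : 0 < ε / ((edgePairs F).card + 1 : ℝ) := by positivity
  obtain ⟨τ, hτ⟩ := exists_lt_of_ciInf_lt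
    (show cutDist g₁ g₂ < ε / ((edgePairs F).card + 1 : ℝ) by rw [h]; exact hpos)
  have hle := (g₁.precomp τ).abs_homDensity_sub_le g₂ F
  rw [g₁.homDensity_precomp τ F] at hle
  refine hle.trans ?_
  have h1 := mul_le_mul_of_nonneg_left hτ.le (Nat.cast_nonneg (α := ℝ) (edgePairs F).card)
  refine h1.trans ?_
  rw [mul_div_assoc', div_le_iff₀ (by positivity)]
  nlinarith

/-- The density `t(F, γ)` of the finite graph `F` in the graphon `γ`. -/
def Graphon.homDensity (γ : Graphon) {k : ℕ} (F : SimpleGraph (Fin k)) : ℝ :=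
  Quot.lift (fun g : GraphFunction => g.homDensity F)
    (fun g₁ g₂ h => g₁.homDensity_eq_of_cutDist g₂ h F) γ

/-- The edge density of a graphon: the density of the graph with two vertices and one edge. -/
def Graphon.edgeDensity (γ : Graphon) : ℝ := γ.homDensity (⊤ : SimpleGraph (Fin 2))

/-! ### Singular graphons -/

/-- The disjoint union of two graphs. The vertices of `F₁` come first. -/
def disjointUnion {k₁ k₂ : ℕ} (F₁ : SimpleGraph (Fin k₁)) (F₂ : SimpleGraph (Fin k₂)) :
    SimpleGraph (Fin (k₁ + k₂)) :=
  F₁.map (Fin.castAdd k₂) ⊔ F₂.map (Fin.natAdd k₁)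

/-- The graph obtained from the disjoint union of `F₁` and `F₂` by identifying the vertex `i₁` of
`F₁` with the vertex `i₂` of `F₂`. It has `k₁ + (k₂ + 1) - 1` vertices: those of `F₁` come first,
then those of `F₂` different from `i₂`, in their order. -/
def joinAt {k₁ k₂ : ℕ} (F₁ : SimpleGraph (Fin k₁)) (F₂ : SimpleGraph (Fin (k₂ + 1)))
    (i₁ : Fin k₁) (i₂ : Fin (k₂ + 1)) : SimpleGraph (Fin (k₁ + k₂)) :=
  F₁.map (Fin.castAdd k₂) ⊔
    F₂.map (Fin.insertNth (α := fun _ => Fin (k₁ + k₂)) i₂ (Fin.castAdd k₂ i₁)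
      (fun j => Fin.natAdd k₁ j))

/-- A graphon `γ` is singular if `t(F₁ ⊔ F₂, γ)` is the average, over the pairs of vertices
`(i₁, i₂)`, of `t((F₁ ⋈ F₂)(i₁, i₂), γ)`, for all non-empty finite graphs `F₁` and `F₂`, here with
`k₁ + 1` and `k₂ + 1` vertices. -/
def Graphon.IsSingular (γ : Graphon) : Prop :=
  ∀ (k₁ k₂ : ℕ) (F₁ : SimpleGraph (Fin (k₁ + 1))) (F₂ : SimpleGraph (Fin (k₂ + 1))),
    γ.homDensity (disjointUnion F₁ F₂)
      = 1 / (((k₁ : ℝ) + 1) * ((k₂ : ℝ) + 1)) *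
        ∑ i₁ : Fin (k₁ + 1), ∑ i₂ : Fin (k₂ + 1), γ.homDensity (joinAt F₁ F₂ i₁ i₂)

/-! ### W-random graphs -/

/-- The indices of the variables `X_i` and `U_{ij}`, `i < j`, that define `G_n(γ)`. -/
abbrev SampleIndex (n : ℕ) : Type := Fin n ⊕ {q : Fin n × Fin n // q.1 < q.2}

/-- The family `ξ`, made of the variables `X_i = ξ (inl i)` and `U_{ij} = ξ (inr (i, j))`, consists
of independent random variables which are uniformly distributed in `[0,1]`. -/
structure IsUniformSample {Ω : Type*} [MeasurableSpace Ω] (P : Measure Ω) {n : ℕ}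
    (ξ : SampleIndex n → Ω → I) : Prop where
  measurable : ∀ a, Measurable (ξ a)
  uniform : ∀ a, P.map (ξ a) = (volume : Measure I)
  indep : iIndepFun ξ P

/-- The graph on `{0, …, n-1}` in which `i < j` are adjacent if and only if
`U_{ij} ≤ g(X_i, X_j)`, where `X_i = ξ (inl i)` and `U_{ij} = ξ (inr (i, j))`. -/
def wRandomGraph (g : GraphFunction) {n : ℕ} (ξ : SampleIndex n → I) : SimpleGraph (Fin n) :=
  SimpleGraph.fromRel (fun i j => ∃ h : i < j,
    (ξ (Sum.inr ⟨(i, j), h⟩) : ℝ) ≤ g.toFun (ξ (Sum.inl i)) (ξ (Sum.inl j)))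

open Classical in
/-- The Laplacian matrix `L_G = D_G - A_G`, with complex entries. -/
def graphLaplacian {n : ℕ} (G : SimpleGraph (Fin n)) : Matrix (Fin n) (Fin n) ℂ :=
  G.lapMatrix ℂ

/-- The determinant of `(1 + p z) I_n + z diag(ε_1, …, ε_n) - z L_G / n`. -/
def modifiedLaplacianDet {n : ℕ} (G : SimpleGraph (Fin n)) (p : ℝ) (ε : Fin n → ℝ) (z : ℂ) : ℂ :=
  ((1 + (p : ℂ) * z) • (1 : Matrix (Fin n) (Fin n) ℂ)
    + z • Matrix.diagonal (fun i => (ε i : ℂ)) - (z / (n : ℂ)) • graphLaplacian G).det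

end

/-!
Each row of a Laplacian is linear in the corresponding row of edge weights, so the determinant
expands over the self-maps `f` of the vertex set, the `i`-th row choosing the edge from `i` to
`f i`. Maps with a cycle of length at least two contribute nothing, because the rows along the
cycle add up to zero; the remaining maps choose forests.

If the degree of `g` is almost everywhere `p`, removing the leaves of a forest one at a time shows
that its edges are all present in the random graph with probability `p` to the number of edges.
Hence the expected determinant is that of the complete graph with edge weights multiplied by `p`,
whose Laplacian is a scalar matrix minus the rank-one matrix with all entries equal to `1`.

Singularity applied to two single edges gives `(∫ deg)² = ∫ deg²`: the degree has variance zero.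
-/

section ForestMap

variable {ι : Type*}

/-- A self-map is a forest map if the functional graph `i ↦ f i` is a forest rooted at the fixed
points of `f`, that is, if it has no cycles of length at least two. -/
def IsForestMap (f : ι → ι) : Prop :=
  Function.periodicPts f ⊆ Function.fixedPoints f

theorem IsForestMap.exists_leaf {f : ι → ι} (hf : IsForestMap f) {S : Finset ι}
    (hS : S.Nonempty) (hne : ∀ i ∈ S, f i ≠ i) : ∃ i ∈ S, ∀ j ∈ S, f j ≠ i := by
  classical
  by_contra! hsurj
  have himage : S.image f = S := (Finset.eq_of_subset_of_card_le
    (fun i hi => Finset.mem_image.2 (hsurj i hi)) Finset.card_image_le).symm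
  have hmaps : Set.MapsTo f S S := fun i hi => by
    rw [← himage]
    exact Finset.mem_coe.2 (Finset.mem_image_of_mem f hi)
  have hinj : Set.InjOn f S := Finset.card_image_iff.1 (by rw [himage])
  obtain ⟨i, hi⟩ := hS
  obtain ⟨m, hm, hper⟩ := ((hmaps.restrict_inj).2 hinj).mem_periodicPts ⟨i, hi⟩
  have hperf : Function.IsPeriodicPt f m i := hper.map (g := Subtype.val) fun _ => rfl
  exact hne i hi (hf (Function.mk_mem_periodicPts hm hperf))

end ForestMap

section KilledLaplacian

variable {ι R : Type*} [Fintype ι] [DecidableEq ι] [CommRing R]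

/-- The Laplacian of the directed graph with edge weights `W i j`, `i ≠ j`, killed at rate `W i i`
at the vertex `i`: the off-diagonal entries are `-W i j`, and the `i`-th row sums to `W i i`. -/
def killedLaplacian (W : Matrix ι ι R) : Matrix ι ι R :=
  Matrix.diagonal (fun i => W i i + ∑ j, W i j) - W

theorem killedLaplacian_diagonal_add_smul_adjMatrix (c : ι → R) (t : R) (G : SimpleGraph ι)
    [DecidableRel G.Adj] :
    killedLaplacian (Matrix.diagonal c + t • G.adjMatrix R)
      = Matrix.diagonal c + t • G.lapMatrix R := by
  have hdiag (i : ι) : (Matrix.diagonal c + t • G.adjMatrix R) i i = c i := by simp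
  have hrow (i : ι) : ∑ j, (Matrix.diagonal c + t • G.adjMatrix R) i j = c i + t * G.degree i := by
    simp [Finset.sum_add_distrib, Matrix.diagonal_apply, SimpleGraph.adjMatrix_apply,
      Finset.sum_ite, ← SimpleGraph.card_neighborFinset_eq_degree,
      SimpleGraph.neighborFinset_eq_filter, mul_comm]
  simp only [killedLaplacian, hdiag, hrow, SimpleGraph.lapMatrix, SimpleGraph.degMatrix]
  ext i j
  by_cases hij : i = j
  · subst hij
    simp
  · simp [hij]

theorem killedLaplacian_row (W : Matrix ι ι R) (i : ι) :
    killedLaplacian W i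
      = ∑ j, W i j • killedLaplacian ((1 : Matrix ι ι R).submatrix (fun _ => j) id) i := by
  ext k
  simp [killedLaplacian, Matrix.diagonal_apply, Matrix.one_apply, Finset.sum_apply, mul_sub,
    Finset.sum_sub_distrib, mul_add, Finset.sum_add_distrib]

/-- Each row of the Laplacian is linear in the corresponding row of `W`. The `i`-th row of
`(1 : Matrix ι ι R).submatrix f id` is the basis vector at `f i`: this is the adjacency matrix of
the functional graph `i ↦ f i`. -/
theorem det_killedLaplacian (W : Matrix ι ι R) :
    (killedLaplacian W).det = ∑ f : ι → ι,
      (∏ i, W i (f i)) * (killedLaplacian ((1 : Matrix ι ι R).submatrix f id)).det := by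
  have hrow : killedLaplacian W = fun i => ∑ j,
      W i j • killedLaplacian ((1 : Matrix ι ι R).submatrix (fun _ => j) id) i :=
    funext (killedLaplacian_row W)
  rw [hrow]
  refine ((Matrix.detRowAlternating (R := R) (n := ι)).toMultilinearMap.map_sum _).trans
    (Finset.sum_congr rfl fun f _ => ?_)
  exact MultilinearMap.map_smul_univ _ _ _

/-- Along a cycle of length at least two, the rows `e_i - e_{f i}` add up to zero. -/
theorem det_killedLaplacian_submatrix_eq_zero [IsDomain R] {f : ι → ι} (hf : ¬ IsForestMap f) :
    (killedLaplacian ((1 : Matrix ι ι R).submatrix f id)).det = 0 := by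
  obtain ⟨i, hper, hfix⟩ := Set.not_subset.1 hf
  set m := Function.minimalPeriod f i
  have hm : 0 < m := Function.minimalPeriod_pos_of_mem_periodicPts hper
  have hrow (k : ℕ) : killedLaplacian ((1 : Matrix ι ι R).submatrix f id) (f^[k] i)
      = Pi.single (f^[k] i) 1 - Pi.single (f^[k + 1] i) 1 := by
    have hmove : f (f^[k] i) ≠ f^[k] i := fun h => hfix <| by
      rw [Function.mem_fixedPoints, ← Function.minimalPeriod_eq_one_iff_isFixedPt,
        ← Function.minimalPeriod_apply_iterate hper k,
        Function.minimalPeriod_eq_one_iff_isFixedPt]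
      exact h
    ext l
    simp [killedLaplacian, Function.iterate_succ_apply', Matrix.diagonal_apply, Matrix.one_apply,
      Pi.single_apply, hmove.symm, eq_comm]
  refine Matrix.exists_vecMul_eq_zero_iff.1
    ⟨∑ k ∈ Finset.range m, Pi.single (f^[k] i) 1, fun h => ?_, ?_⟩
  · have hi := congrFun h i
    rw [Finset.sum_apply, Finset.sum_eq_single_of_mem 0 (Finset.mem_range.2 hm)] at hi
    · simp at hi
    · intro k hk hk0
      refine Pi.single_eq_of_ne (fun hki => ?_) 1
      exact Function.not_isPeriodicPt_of_pos_of_lt_minimalPeriod hk0 (Finset.mem_range.1 hk)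
        hki.symm
  · rw [Matrix.sum_vecMul]
    simp only [Matrix.single_one_vecMul, Matrix.row, hrow]
    rw [Finset.sum_range_sub', Function.iterate_minimalPeriod, Function.iterate_zero, id, sub_self]

end KilledLaplacian

section CompleteGraph

variable {ι R : Type*} [Fintype ι] [DecidableEq ι] [CommRing R]

theorem det_updateRow_diagonal (a : ι → R) (i : ι) (v : ι → R) :
    ((Matrix.diagonal a).updateRow i v).det = v i * ∏ j ∈ Finset.univ.erase i, a j := by
  rw [← Matrix.cramer_transpose_apply, Matrix.diagonal_transpose,
    Matrix.cramer_eq_adjugate_mulVec, Matrix.adjugate_diagonal, Matrix.mulVec_diagonal, mul_comm]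

theorem det_diagonal_add_vecMulVec (a u v : ι → R) :
    (Matrix.diagonal a + Matrix.vecMulVec u v).det
      = ∏ i, a i + ∑ i, u i * v i * ∏ j ∈ Finset.univ.erase i, a j := by
  suffices h : ∀ S : Finset ι,
      (Matrix.diagonal a + Matrix.vecMulVec (fun i => if i ∈ S then u i else 0) v).det
        = ∏ i, a i + ∑ i ∈ S, u i * v i * ∏ j ∈ Finset.univ.erase i, a j by
    simpa using h Finset.univ
  intro S
  induction S using Finset.induction_on with
  | empty => simp [show (fun _ : ι => (0 : R)) = 0 from rfl]
  | insert i S hi ih =>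
    set M := Matrix.diagonal a + Matrix.vecMulVec (fun j => if j ∈ S then u j else 0) v with hM
    have hsplit :
        Matrix.diagonal a + Matrix.vecMulVec (fun j => if j ∈ insert i S then u j else 0) v
        = M.updateRow i (M i + u i • v) := by
      ext j k
      by_cases hj : j = i
      · subst hj
        simp [hM, hi, Matrix.vecMulVec_apply]
      · simp [hM, hj, Matrix.vecMulVec_apply]
    have hclear : (M.updateRow i v).det = ((Matrix.diagonal a).updateRow i v).det := by
      refine Matrix.det_eq_of_forall_row_eq_smul_add_const (fun j => if j ∈ S then u j else 0) i
        (if_neg hi) fun j k => ?_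
      by_cases hj : j = i
      · subst hj
        simp [hi]
      · simp [hM, hj, Matrix.vecMulVec_apply]
    rw [hsplit, Matrix.det_updateRow_add, Matrix.det_updateRow_smul, Matrix.updateRow_eq_self, ih,
      hclear, det_updateRow_diagonal, Finset.sum_insert hi]
    ring

theorem lapMatrix_top :
    (⊤ : SimpleGraph ι).lapMatrix R
      = Matrix.diagonal (fun _ => (Fintype.card ι : R)) - Matrix.vecMulVec 1 1 := by
  ext i j
  have hcard : 1 ≤ Fintype.card ι := Fintype.card_pos_iff.2 ⟨i⟩
  by_cases hij : i = j
  · subst hij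
    simp [SimpleGraph.lapMatrix, SimpleGraph.degMatrix, hcard]
  · simp [SimpleGraph.lapMatrix, SimpleGraph.degMatrix, hij]

theorem det_diagonal_add_smul_lapMatrix_top (a : ι → R) (t : R) :
    (Matrix.diagonal (fun i => a i - Fintype.card ι * t)
        + t • (⊤ : SimpleGraph ι).lapMatrix R).det
      = ∏ i, a i - t * ∑ i, ∏ j ∈ Finset.univ.erase i, a j := by
  have hrank : Matrix.diagonal (fun i => a i - Fintype.card ι * t)
        + t • (⊤ : SimpleGraph ι).lapMatrix R
      = Matrix.diagonal a + Matrix.vecMulVec (fun _ => -t) 1 := by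
    rw [lapMatrix_top]
    ext i j
    by_cases hij : i = j
    · subst hij
      simp only [Matrix.add_apply, Matrix.smul_apply, Matrix.sub_apply, Matrix.diagonal_apply_eq,
        Matrix.vecMulVec_apply, Pi.one_apply, smul_eq_mul]
      ring
    · simp [hij]
  rw [hrank, det_diagonal_add_vecMulVec, sub_eq_add_neg]
  simp only [Pi.one_apply, mul_one, neg_mul, Finset.sum_neg_distrib, Finset.mul_sum]

theorem det_diagonal_add_smul_lapMatrix_top_eq_average {K : Type*} [Field K]
    (hcard : (Fintype.card ι : K) ≠ 0) (a : ι → K) (q : K) :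
    (Matrix.diagonal (fun i => a i + q)
        + (-(q / Fintype.card ι)) • (⊤ : SimpleGraph ι).lapMatrix K).det
      = 1 / Fintype.card ι * ∑ i, (a i + q) * ∏ j ∈ Finset.univ.erase i, a j := by
  have hdiag : (fun i => a i + q)
      = fun i => a i - Fintype.card ι * -(q / Fintype.card ι) := by
    funext i
    rw [mul_neg, mul_div_cancel₀ _ hcard, sub_neg_eq_add]
  have hsum : ∑ i, (a i + q) * ∏ j ∈ Finset.univ.erase i, a j
      = Fintype.card ι * ∏ i, a i + q * ∑ i, ∏ j ∈ Finset.univ.erase i, a j := by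
    simp only [add_mul, Finset.mul_prod_erase _ _ (Finset.mem_univ _), Finset.sum_add_distrib,
      Finset.sum_const, Finset.card_univ, nsmul_eq_mul, Finset.mul_sum]
  rw [hsum, hdiag, det_diagonal_add_smul_lapMatrix_top]
  field_simp
  ring

theorem sum_mul_prod_erase {K : Type*} [Field K] {a : ι → K} (ha : ∀ i, a i ≠ 0) (b : ι → K) :
    ∑ i, b i * ∏ j ∈ Finset.univ.erase i, a j = (∏ i, a i) * ∑ i, b i / a i := by
  rw [Finset.mul_sum]
  refine Finset.sum_congr rfl fun i hi => ?_
  rw [← Finset.mul_prod_erase _ _ hi, mul_comm (a i), mul_assoc, mul_div_cancel₀ _ (ha i), mul_comm]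

end CompleteGraph

theorem prod_diagonal_add_smul_adjMatrix {ι R : Type*} [Fintype ι] [DecidableEq ι]
    [CommRing R] (c : ι → R) (t : R) (G : SimpleGraph ι) [DecidableRel G.Adj] (f : ι → ι) :
    ∏ i, (Matrix.diagonal c + t • G.adjMatrix R) i (f i)
      = ((∏ i with f i = i, c i) * t ^ ({i | f i ≠ i} : Finset ι).card)
        * ∏ i with f i ≠ i, G.adjMatrix R i (f i) := by
  rw [← Finset.prod_filter_mul_prod_filter_not Finset.univ (fun i => f i = i), mul_assoc,
    ← Finset.prod_const, ← Finset.prod_mul_distrib]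
  congr 1
  · refine Finset.prod_congr rfl fun i hi => ?_
    simp [(Finset.mem_filter.1 hi).2]
  · refine Finset.prod_congr rfl fun i hi => ?_
    simp [Matrix.diagonal_apply_ne' _ (Finset.mem_filter.1 hi).2]

theorem integrable_prod_adjMatrix {ι 𝕜 Ω : Type*} [RCLike 𝕜] [MeasurableSpace Ω] {μ : Measure Ω}
    [IsFiniteMeasure μ] {G : Ω → SimpleGraph ι} [∀ ω, DecidableRel (G ω).Adj]
    (hG : ∀ i j, Measurable fun ω => (G ω).adjMatrix 𝕜 i j) (S : Finset ι) (f : ι → ι) :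
    Integrable (fun ω => ∏ i ∈ S, (G ω).adjMatrix 𝕜 i (f i)) μ := by
  refine Integrable.of_bound (C := 1)
    (Finset.measurable_prod _ fun i _ => hG i (f i)).aestronglyMeasurable ?_
  refine Filter.Eventually.of_forall fun ω => ?_
  rw [norm_prod]
  refine Finset.prod_le_one (fun i _ => norm_nonneg _) fun i _ => ?_
  rw [SimpleGraph.adjMatrix_apply]
  split_ifs <;> simp

section Expectation

variable {ι 𝕜 Ω : Type*} [Fintype ι] [DecidableEq ι] [RCLike 𝕜] [MeasurableSpace Ω] {μ : Measure Ω}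
  {W : Ω → Matrix ι ι 𝕜}

theorem integrable_det_killedLaplacian
    (hint : ∀ f : ι → ι, Integrable (fun ω => ∏ i, W ω i (f i)) μ) :
    Integrable (fun ω => (killedLaplacian (W ω)).det) μ := by
  simp only [fun ω => det_killedLaplacian (W ω)]
  exact integrable_finsetSum _ fun f _ => (hint f).mul_const _

theorem integral_det_killedLaplacian {M : Matrix ι ι 𝕜}
    (hint : ∀ f : ι → ι, Integrable (fun ω => ∏ i, W ω i (f i)) μ)
    (hforest : ∀ f : ι → ι, IsForestMap f → ∫ ω, ∏ i, W ω i (f i) ∂μ = ∏ i, M i (f i)) :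
    ∫ ω, (killedLaplacian (W ω)).det ∂μ = (killedLaplacian M).det := by
  simp only [fun ω => det_killedLaplacian (W ω)]
  rw [det_killedLaplacian M, integral_finsetSum _ fun f _ => (hint f).mul_const _]
  refine Finset.sum_congr rfl fun f _ => ?_
  rw [integral_mul_const]
  by_cases hf : IsForestMap f
  · rw [hforest f hf]
  · rw [det_killedLaplacian_submatrix_eq_zero hf, mul_zero, mul_zero]

variable {G : Ω → SimpleGraph ι} [∀ ω, DecidableRel (G ω).Adj]

theorem integrable_det_diagonal_add_smul_lapMatrix [IsFiniteMeasure μ]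
    (hG : ∀ i j, Measurable fun ω => (G ω).adjMatrix 𝕜 i j) (c : ι → 𝕜) (t : 𝕜) :
    Integrable (fun ω => (Matrix.diagonal c + t • (G ω).lapMatrix 𝕜).det) μ := by
  simp only [← killedLaplacian_diagonal_add_smul_adjMatrix]
  refine integrable_det_killedLaplacian fun f => ?_
  simp only [prod_diagonal_add_smul_adjMatrix]
  exact (integrable_prod_adjMatrix hG _ f).const_mul _

theorem integral_det_diagonal_add_smul_lapMatrix [IsFiniteMeasure μ]
    (hG : ∀ i j, Measurable fun ω => (G ω).adjMatrix 𝕜 i j) {p : 𝕜}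
    (hforest : ∀ f : ι → ι, IsForestMap f →
      ∫ ω, ∏ i with f i ≠ i, (G ω).adjMatrix 𝕜 i (f i) ∂μ
        = p ^ ({i | f i ≠ i} : Finset ι).card) (c : ι → 𝕜) (t : 𝕜) :
    ∫ ω, (Matrix.diagonal c + t • (G ω).lapMatrix 𝕜).det ∂μ
      = (Matrix.diagonal c + (t * p) • (⊤ : SimpleGraph ι).lapMatrix 𝕜).det := by
  simp only [← killedLaplacian_diagonal_add_smul_adjMatrix]
  refine integral_det_killedLaplacian (fun f => ?_) fun f hf => ?_
  · simp only [prod_diagonal_add_smul_adjMatrix]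
    exact (integrable_prod_adjMatrix hG _ f).const_mul _
  · have hcomplete : ∏ i with f i ≠ i, (⊤ : SimpleGraph ι).adjMatrix 𝕜 i (f i) = 1 :=
      Finset.prod_eq_one fun i hi => by simp [(Finset.mem_filter.1 hi).2.symm]
    simp only [prod_diagonal_add_smul_adjMatrix]
    rw [integral_const_mul, hforest f hf, hcomplete, mul_one, mul_pow, mul_assoc]

end Expectation

section Coordinates

variable {κ : Type*} [Fintype κ] [DecidableEq κ] {X : κ → Type*} [∀ i, MeasurableSpace (X i)]
  (μ : ∀ i, Measure (X i)) [∀ i, SigmaFinite (μ i)] (a : κ) [IsProbabilityMeasure (μ a)]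

theorem measurePreserving_update_pi :
    MeasurePreserving (fun q : (∀ i, X i) × X a => Function.update q.1 a q.2)
      ((Measure.pi μ).prod (μ a)) (Measure.pi μ) := by
  have hmeas : Measurable fun q : (∀ i, X i) × X a => Function.update q.1 a q.2 :=
    measurable_update'
  refine ⟨hmeas, (Measure.pi_eq fun s hs => ?_).symm⟩
  have hpreimage : (fun q : (∀ i, X i) × X a => Function.update q.1 a q.2) ⁻¹' Set.univ.pi s
      = Set.univ.pi (Function.update s a Set.univ) ×ˢ s a := by
    ext q
    simp only [Set.mem_preimage, Set.mem_prod, Set.mem_univ_pi]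
    rw [Function.forall_update_iff q.1 fun i y => y ∈ s i,
      Function.forall_update_iff s fun i t => q.1 i ∈ t]
    simp [and_comm]
  rw [Measure.map_apply hmeas (MeasurableSet.univ_pi hs), hpreimage, Measure.prod_prod,
    Measure.pi_pi, ← Finset.prod_erase_mul _ _ (Finset.mem_univ a), Function.update_self,
    measure_univ, mul_one, ← Finset.prod_erase_mul _ _ (Finset.mem_univ a)]
  congr 1
  exact Finset.prod_congr rfl fun i hi => by rw [Function.update_of_ne (Finset.ne_of_mem_erase hi)]

variable {μ}

theorem integral_update_pi {E : Type*} [NormedAddCommGroup E] [NormedSpace ℝ E]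
    {f : (∀ i, X i) → E} (hf : Integrable f (Measure.pi μ)) :
    ∫ x, f x ∂Measure.pi μ = ∫ x, ∫ v, f (Function.update x a v) ∂μ a ∂Measure.pi μ := by
  have hmp := measurePreserving_update_pi μ a
  refine Eq.trans ?_ (integral_prod _ (hmp.integrable_comp_of_integrable hf))
  have hmap := integral_map hmp.measurable.aemeasurable (hmp.map_eq.symm ▸ hf.aestronglyMeasurable)
  rwa [hmp.map_eq] at hmap

variable {𝕜 : Type*} [RCLike 𝕜] {a}

theorem integral_mul_of_dependsOn {F R : (∀ i, X i) → 𝕜}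
    (hint : Integrable (fun x => F x * R x) (Measure.pi μ)) (hR : DependsOn R {a}ᶜ) :
    ∫ x, F x * R x ∂Measure.pi μ
      = ∫ x, (∫ v, F (Function.update x a v) ∂μ a) * R x ∂Measure.pi μ := by
  have hupdate (x : ∀ i, X i) (v : X a) : R (Function.update x a v) = R x :=
    hR fun i hi => Function.update_of_ne hi v x
  rw [integral_update_pi a hint]
  simp only [hupdate, integral_mul_const]

end Coordinates

section UniformCoordinates

variable {κ 𝕜 : Type*} [Fintype κ] [RCLike 𝕜] {a b : κ} {R : (κ → I) → 𝕜}

theorem integral_threshold {c : ℝ} (hc : c ∈ I) :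
    ∫ u : I, (if (u : ℝ) ≤ c then (1 : 𝕜) else 0) = c := by
  have h := integral_indicator_const (μ := (volume : Measure I)) (1 : 𝕜)
    (measurableSet_Iic (a := (⟨c, hc⟩ : I)))
  rw [measureReal_def, unitInterval.volume_Iic, ENNReal.toReal_ofReal hc.1,
    ← RCLike.ofReal_alg] at h
  exact h

theorem integral_threshold_mul {F : (κ → I) → ℝ} (hF : ∀ x, F x ∈ I) (hFa : DependsOn F {a}ᶜ)
    (hRa : DependsOn R {a}ᶜ)
    (hint : Integrable fun x => (if (x a : ℝ) ≤ F x then (1 : 𝕜) else 0) * R x) :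
    ∫ x, (if (x a : ℝ) ≤ F x then (1 : 𝕜) else 0) * R x = ∫ x, (F x : 𝕜) * R x := by
  classical
  have hupdate (x : κ → I) (v : I) : F (Function.update x a v) = F x :=
    hFa fun i hi => Function.update_of_ne hi v x
  refine (integral_mul_of_dependsOn hint hRa).trans ?_
  simp only [hupdate, Function.update_self, integral_threshold (hF _)]
  rfl

theorem integral_kernel_mul {W : I → I → ℝ} (hab : b ≠ a) (hRa : DependsOn R {a}ᶜ)
    (hint : Integrable fun x => (W (x a) (x b) : 𝕜) * R x) :
    ∫ x, (W (x a) (x b) : 𝕜) * R x = ∫ x, ((∫ v, W v (x b) : ℝ) : 𝕜) * R x := by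
  classical
  refine (integral_mul_of_dependsOn hint hRa).trans ?_
  simp only [Function.update_self, Function.update_of_ne hab, integral_ofReal]
  rfl

end UniformCoordinates

namespace GraphFunction

variable (g : GraphFunction)

theorem mem_unitInterval (x y : I) : g.toFun x y ∈ I := ⟨g.nonneg x y, g.le_one x y⟩

/-- The degree `∫ g(x, y) dx` of the point `y`. -/
noncomputable def degree (y : I) : ℝ := ∫ x, g.toFun x y

theorem measurable_degree : Measurable g.degree :=
  (g.measurable_toFun.stronglyMeasurable.integral_prod_left (f := g.toFun)
    (μ := (volume : Measure I))).measurable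

theorem norm_degree_le_one (y : I) : ‖g.degree y‖ ≤ 1 := by
  have h := norm_integral_le_of_norm_le_const (μ := (volume : Measure I))
    (f := fun x => g.toFun x y) (C := 1) <| Filter.Eventually.of_forall fun x => by
      rw [Real.norm_of_nonneg (g.nonneg x y)]
      exact g.le_one x y
  simpa [degree] using h

theorem memLp_degree (r : ENNReal) : MemLp g.degree r :=
  MemLp.of_bound g.measurable_degree.aestronglyMeasurable 1
    (Filter.Eventually.of_forall g.norm_degree_le_one)

theorem ae_integral_right_eq_degree : ∀ᵐ x, ∫ y, g.toFun x y = g.degree x := by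
  have h := g.symm_ae
  rw [Measure.volume_eq_prod] at h
  filter_upwards [Measure.ae_ae_of_ae_prod h] with x hx
  exact integral_congr_ae hx

theorem measurable_toFun_eval {κ : Type*} (a b : κ) :
    Measurable fun x : κ → I => g.toFun (x a) (x b) :=
  g.measurable_toFun.comp (f := fun x : κ → I => (x a, x b))
    ((measurable_pi_apply a).prodMk (measurable_pi_apply b))

section IntegrateOut

variable {κ 𝕜 : Type*} [Fintype κ] [RCLike 𝕜] {a b : κ} {R : (κ → I) → 𝕜}

variable (a b) in
theorem integrable_toFun_mul (hR : Integrable R) :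
    Integrable fun x : κ → I => (g.toFun (x a) (x b) : 𝕜) * R x := by
  refine hR.bdd_mul (c := 1)
    (RCLike.measurable_ofReal.comp (g.measurable_toFun_eval a b)).aestronglyMeasurable
    (Filter.Eventually.of_forall fun x => ?_)
  rw [RCLike.norm_ofReal, abs_of_nonneg (g.nonneg _ _)]
  exact g.le_one _ _

theorem integral_toFun_left_mul (hab : b ≠ a) (hR : Integrable R) (hRa : DependsOn R {a}ᶜ) :
    ∫ x, (g.toFun (x a) (x b) : 𝕜) * R x = ∫ x, (g.degree (x b) : 𝕜) * R x :=
  integral_kernel_mul hab hRa (g.integrable_toFun_mul a b hR)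

theorem integral_toFun_right_mul (hab : b ≠ a) (hR : Integrable R) (hRa : DependsOn R {a}ᶜ) :
    ∫ x, (g.toFun (x b) (x a) : 𝕜) * R x = ∫ x, (g.degree (x b) : 𝕜) * R x := by
  rw [integral_kernel_mul (W := fun x y => g.toFun y x) hab hRa (g.integrable_toFun_mul b a hR)]
  refine integral_congr_ae ?_
  have hmp : MeasurePreserving (fun x : κ → I => x b) volume volume :=
    measurePreserving_eval (fun _ => volume) b
  filter_upwards [hmp.quasiMeasurePreserving.ae g.ae_integral_right_eq_degree] with x hx
  rw [hx]

end IntegrateOut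

section SmallDensities

variable {κ : Type*} [Fintype κ]

theorem integrable_toFun (a b : κ) : Integrable fun x : κ → I => g.toFun (x a) (x b) := by
  simpa using g.integrable_toFun_mul (𝕜 := ℝ) a b (R := fun _ => 1) (integrable_const 1)

theorem integrable_degree_eval (a : κ) : Integrable fun x : κ → I => g.degree (x a) :=
  integrable_comp_eval (memLp_one_iff_integrable.1 (g.memLp_degree 1))

variable {a b c d : κ}

theorem integral_toFun (hab : b ≠ a) :
    ∫ x : κ → I, g.toFun (x a) (x b) = ∫ y, g.degree y := by
  have hleaf : ∫ x : κ → I, g.toFun (x a) (x b) * 1 = ∫ x : κ → I, g.degree (x b) * 1 :=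
    g.integral_toFun_left_mul hab (integrable_const 1) fun _ _ _ => rfl
  simp only [mul_one] at hleaf
  exact hleaf.trans (integral_comp_eval g.measurable_degree.aestronglyMeasurable)

theorem integral_toFun_mul_toFun (hab : b ≠ a) (hcd : d ≠ c) (hac : a ≠ c) (had : a ≠ d)
    (hbc : b ≠ c) (hbd : b ≠ d) :
    ∫ x : κ → I, g.toFun (x a) (x b) * g.toFun (x c) (x d) = (∫ y, g.degree y) ^ 2 := by
  classical
  have hdep (e : κ) (hec : e ≠ c) (hed : e ≠ d) :
      DependsOn (fun x : κ → I => g.toFun (x c) (x d)) {e}ᶜ :=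
    fun x y hxy => by simp only [hxy c hec.symm, hxy d hed.symm]
  calc ∫ x : κ → I, g.toFun (x a) (x b) * g.toFun (x c) (x d)
      = ∫ x : κ → I, g.degree (x b) * g.toFun (x c) (x d) :=
        g.integral_toFun_left_mul hab (g.integrable_toFun c d) (hdep a hac had)
    _ = ∫ x : κ → I, (∫ y, g.degree y) * g.toFun (x c) (x d) := by
        refine (integral_mul_of_dependsOn (a := b) (F := fun x : κ → I => g.degree (x b)) ?_
          (hdep b hbc hbd)).trans ?_
        · exact (g.integrable_toFun_mul (𝕜 := ℝ) c d (g.integrable_degree_eval b)).congr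
            (Filter.Eventually.of_forall fun x => mul_comm _ _)
        · simp only [Function.update_self]
          rfl
    _ = (∫ y, g.degree y) ^ 2 := by
        rw [integral_const_mul, g.integral_toFun hcd, pow_two]

theorem integral_toFun_mul_degree_left (hab : b ≠ a) :
    ∫ x : κ → I, g.toFun (x a) (x b) * g.degree (x a) = ∫ y, g.degree y ^ 2 := by
  refine (g.integral_toFun_right_mul (𝕜 := ℝ) hab.symm (g.integrable_degree_eval a)
    fun x y hxy => by simp only [hxy a hab.symm]).trans ?_
  simp only [RCLike.ofReal_real_eq_id, id, ← pow_two]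
  exact integral_comp_eval (X := fun _ : κ => I) (f := fun y => g.degree y ^ 2)
    (g.measurable_degree.pow_const 2).aestronglyMeasurable

theorem integral_toFun_mul_degree_right (hab : b ≠ a) :
    ∫ x : κ → I, g.toFun (x a) (x b) * g.degree (x b) = ∫ y, g.degree y ^ 2 := by
  refine (g.integral_toFun_left_mul (𝕜 := ℝ) hab (g.integrable_degree_eval b)
    fun x y hxy => by simp only [hxy b hab]).trans ?_
  simp only [RCLike.ofReal_real_eq_id, id, ← pow_two]
  exact integral_comp_eval (X := fun _ : κ => I) (f := fun y => g.degree y ^ 2)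
    (g.measurable_degree.pow_const 2).aestronglyMeasurable

end SmallDensities

theorem homDensity_edge : g.homDensity (⊤ : SimpleGraph (Fin 2)) = ∫ y, g.degree y := by
  have hedges : edgePairs (⊤ : SimpleGraph (Fin 2)) = {(0, 1)} := by
    ext ⟨a, b⟩
    simp only [edgePairs, Finset.mem_filter, Finset.mem_univ, true_and, SimpleGraph.top_adj]
    revert a b
    decide
  simp only [homDensity, hedges, Finset.prod_singleton]
  exact g.integral_toFun (by decide)

theorem homDensity_disjointUnion_edge_edge :
    g.homDensity (disjointUnion (⊤ : SimpleGraph (Fin 2)) (⊤ : SimpleGraph (Fin 2)))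
      = (∫ y, g.degree y) ^ 2 := by
  have hedges : edgePairs (disjointUnion (⊤ : SimpleGraph (Fin 2)) (⊤ : SimpleGraph (Fin 2)))
      = {(0, 1), (2, 3)} := by
    ext ⟨a, b⟩
    simp only [edgePairs, Finset.mem_filter, Finset.mem_univ, true_and, disjointUnion,
      SimpleGraph.sup_adj, SimpleGraph.map_adj', SimpleGraph.top_adj]
    revert a b
    decide
  have hne : ((0, 1) : Fin (2 + 2) × Fin (2 + 2)) ≠ (2, 3) := by decide
  simp only [homDensity, hedges, Finset.prod_pair hne]
  apply g.integral_toFun_mul_toFun <;> decide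

theorem homDensity_joinAt_edge_edge (i₁ i₂ : Fin 2) :
    g.homDensity (joinAt (k₂ := 1) (⊤ : SimpleGraph (Fin 2)) (⊤ : SimpleGraph (Fin 2)) i₁ i₂)
      = ∫ y, g.degree y ^ 2 := by
  have hedges : edgePairs
      (joinAt (k₂ := 1) (⊤ : SimpleGraph (Fin 2)) (⊤ : SimpleGraph (Fin 2)) i₁ i₂)
      = {(Fin.castAdd 1 i₁, 2), (0, 1)} := by
    ext ⟨a, b⟩
    simp only [edgePairs, Finset.mem_filter, Finset.mem_univ, true_and, joinAt,
      SimpleGraph.sup_adj, SimpleGraph.map_adj', SimpleGraph.top_adj]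
    revert i₁ i₂ a b
    decide
  have hne : ((Fin.castAdd 1 i₁, 2) : Fin (2 + 1) × Fin (2 + 1)) ≠ (0, 1) := by
    simp [Prod.ext_iff]
  have hcenter : (Fin.castAdd 1 i₁ : Fin (2 + 1)) ≠ 2 := by
    clear * -
    revert i₁
    decide
  have hpendant : ∫ x : Fin (2 + 1) → I,
        g.toFun (x (Fin.castAdd 1 i₁)) (x 2) * g.toFun (x 0) (x 1)
      = ∫ x : Fin (2 + 1) → I, g.degree (x (Fin.castAdd 1 i₁)) * g.toFun (x 0) (x 1) :=
    g.integral_toFun_right_mul hcenter (g.integrable_toFun 0 1)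
      fun x y hxy => by simp only [hxy 0 (by decide), hxy 1 (by decide)]
  simp only [homDensity, hedges, Finset.prod_pair hne, hpendant, mul_comm (g.degree _)]
  fin_cases i₁
  · exact g.integral_toFun_mul_degree_left (by decide)
  · exact g.integral_toFun_mul_degree_right (by decide)

end GraphFunction

/-- For a singular graphon, `t(K₂ ⊔ K₂) = t(K_{1,2})` says that the degree has variance zero. -/
theorem Graphon.IsSingular.ae_degree_eq {γ : Graphon} (hγ : γ.IsSingular) {p : ℝ}
    (hp : γ.edgeDensity = p) {g : GraphFunction} (hg : Graphon.mk g = γ) :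
    ∀ᵐ y, g.degree y = p := by
  subst hg
  have hmean : ∫ y, g.degree y = p := g.homDensity_edge.symm.trans hp
  have hsquare : (∫ y, g.degree y) ^ 2 = ∫ y, g.degree y ^ 2 := by
    have hjoin (i₁ i₂ : Fin 2) : (Graphon.mk g).homDensity (joinAt (k₂ := 1) ⊤ ⊤ i₁ i₂)
        = ∫ y, g.degree y ^ 2 := g.homDensity_joinAt_edge_edge i₁ i₂
    refine g.homDensity_disjointUnion_edge_edge.symm.trans ((hγ 1 1 ⊤ ⊤).trans ?_)
    simp only [Nat.reduceAdd, hjoin, Finset.sum_const, Finset.card_univ, Fintype.card_fin]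
    norm_num
    ring
  have hvariance : variance g.degree volume = 0 := by
    rw [variance_eq_sub (g.memLp_degree 2), hsquare]
    exact sub_self _
  have hevariance : evariance g.degree volume = 0 := by
    rw [← (g.memLp_degree 2).ofReal_variance_eq, hvariance, ENNReal.ofReal_zero]
  filter_upwards [(evariance_eq_zero_iff g.measurable_degree.aemeasurable).1 hevariance] with y hy
  rw [hy, hmean]

theorem GraphFunction.integral_degree_eval_mul {g : GraphFunction} {p : ℝ}
    (hdeg : ∀ᵐ y, g.degree y = p) {κ 𝕜 : Type*} [Fintype κ] [RCLike 𝕜] (b : κ)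
    (R : (κ → I) → 𝕜) : ∫ x, (g.degree (x b) : 𝕜) * R x = p * ∫ x, R x := by
  have hmp : MeasurePreserving (fun x : κ → I => x b) volume volume :=
    measurePreserving_eval (fun _ => volume) b
  rw [← integral_const_mul]
  refine integral_congr_ae ?_
  filter_upwards [hmp.quasiMeasurePreserving.ae hdeg] with x hx
  rw [hx]

section WRandomGraph

variable {n : ℕ} {𝕜 : Type*} [RCLike 𝕜] (g : GraphFunction)

theorem wRandomGraph_adj_of_lt {i j : Fin n} (hij : i < j) (x : SampleIndex n → I) :
    (wRandomGraph g x).Adj i j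
      ↔ (x (Sum.inr ⟨(i, j), hij⟩) : ℝ) ≤ g.toFun (x (Sum.inl i)) (x (Sum.inl j)) := by
  simp [wRandomGraph, hij, hij.ne, hij.not_gt]

variable [∀ x : SampleIndex n → I, DecidableRel (wRandomGraph g x).Adj]

theorem measurable_adjMatrix_wRandomGraph (i j : Fin n) :
    Measurable fun x : SampleIndex n → I => (wRandomGraph g x).adjMatrix 𝕜 i j := by
  have hlt (i j : Fin n) (hij : i < j) :
      Measurable fun x : SampleIndex n → I => (wRandomGraph g x).adjMatrix 𝕜 i j := by
    simp only [SimpleGraph.adjMatrix_apply, wRandomGraph_adj_of_lt g hij]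
    exact Measurable.ite (measurableSet_le (measurable_subtype_coe.comp (measurable_pi_apply _))
      (g.measurable_toFun_eval _ _)) measurable_const measurable_const
  rcases lt_trichotomy i j with hij | rfl | hij
  · exact hlt i j hij
  · simp
  · simp only [SimpleGraph.adjMatrix_apply, SimpleGraph.adj_comm _ i j]
    exact hlt j i hij

/-- The sample coordinates that do not involve the vertex `k`: they determine the graph obtained
from the `W`-random graph by deleting `k`. -/
def coordinatesAvoiding (k : Fin n) : Set (SampleIndex n) :=
  {a | a.elim (fun i => i ≠ k) fun q => q.1.1 ≠ k ∧ q.1.2 ≠ k}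

theorem dependsOn_adjMatrix_wRandomGraph {i j k : Fin n} (hik : i ≠ k) (hjk : j ≠ k) :
    DependsOn (fun x => (wRandomGraph g x).adjMatrix 𝕜 i j) (coordinatesAvoiding k) := by
  intro x y hxy
  have hi : x (Sum.inl i) = y (Sum.inl i) := hxy _ hik
  have hj : x (Sum.inl j) = y (Sum.inl j) := hxy _ hjk
  have hij (h : i < j) : x (Sum.inr ⟨(i, j), h⟩) = y (Sum.inr ⟨(i, j), h⟩) := hxy _ ⟨hik, hjk⟩
  have hji (h : j < i) : x (Sum.inr ⟨(j, i), h⟩) = y (Sum.inr ⟨(j, i), h⟩) := hxy _ ⟨hjk, hik⟩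
  have hadj : (wRandomGraph g x).Adj i j ↔ (wRandomGraph g y).Adj i j := by
    simp only [wRandomGraph, SimpleGraph.fromRel_adj, hi, hj, hij, hji]
  simp only [SimpleGraph.adjMatrix_apply, hadj]

variable {g} {p : ℝ} (hdeg : ∀ᵐ y, g.degree y = p)

include hdeg

theorem integral_adjMatrix_wRandomGraph_mul {i j : Fin n} (hij : i ≠ j)
    {R : (SampleIndex n → I) → 𝕜} (hR : Integrable R) (hRi : DependsOn R (coordinatesAvoiding i)) :
    ∫ x, (wRandomGraph g x).adjMatrix 𝕜 i j * R x = p * ∫ x, R x := by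
  have hvertex : DependsOn R {Sum.inl i}ᶜ := hRi.mono fun a ha hai => by
    subst hai
    exact ha rfl
  have hpair (q : {q : Fin n × Fin n // q.1 < q.2}) (hq : q.1.1 = i ∨ q.1.2 = i) :
      DependsOn R {Sum.inr q}ᶜ := hRi.mono fun a ha haq => by
    subst haq
    exact hq.elim ha.1 ha.2
  have hint : Integrable fun x => (wRandomGraph g x).adjMatrix 𝕜 i j * R x :=
    hR.bdd_mul (c := 1) (measurable_adjMatrix_wRandomGraph g i j).aestronglyMeasurable <|
      Filter.Eventually.of_forall fun x => by
        rw [SimpleGraph.adjMatrix_apply]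
        split_ifs <;> simp
  have hne : (Sum.inl j : SampleIndex n) ≠ Sum.inl i := Sum.inl_injective.ne hij.symm
  have hdep (q : {q : Fin n × Fin n // q.1 < q.2}) (a b : Fin n) :
      DependsOn (fun x : SampleIndex n → I => g.toFun (x (Sum.inl a)) (x (Sum.inl b)))
        {Sum.inr q}ᶜ :=
    fun x y hxy => by simp only [hxy (Sum.inl a) Sum.inl_ne_inr, hxy (Sum.inl b) Sum.inl_ne_inr]
  rw [← GraphFunction.integral_degree_eval_mul hdeg (Sum.inl j) R]
  rcases lt_or_gt_of_ne hij with h | h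
  · simp only [SimpleGraph.adjMatrix_apply, wRandomGraph_adj_of_lt g h] at hint ⊢
    rw [integral_threshold_mul (fun x => g.mem_unitInterval _ _) (hdep _ i j)
      (hpair _ (Or.inl rfl)) hint]
    exact g.integral_toFun_left_mul hne hR hvertex
  · simp only [SimpleGraph.adjMatrix_apply, SimpleGraph.adj_comm _ i j,
      wRandomGraph_adj_of_lt g h] at hint ⊢
    rw [integral_threshold_mul (fun x => g.mem_unitInterval _ _) (hdep _ j i)
      (hpair _ (Or.inr rfl)) hint]
    exact g.integral_toFun_right_mul hne hR hvertex

theorem integral_prod_adjMatrix_wRandomGraph {f : Fin n → Fin n} (hf : IsForestMap f)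
    {S : Finset (Fin n)} (hS : ∀ i ∈ S, f i ≠ i) :
    ∫ x, ∏ i ∈ S, (wRandomGraph g x).adjMatrix 𝕜 i (f i) = (p : 𝕜) ^ S.card := by
  induction S using Finset.strongInduction with
  | H S ih =>
    obtain rfl | hne := S.eq_empty_or_nonempty
    · simp
    obtain ⟨i, hi, hleaf⟩ := hf.exists_leaf hne hS
    have hrest : DependsOn
        (fun x => ∏ j ∈ S.erase i, (wRandomGraph g x).adjMatrix 𝕜 j (f j))
        (coordinatesAvoiding i) := fun x y hxy => Finset.prod_congr rfl fun j hj =>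
      dependsOn_adjMatrix_wRandomGraph g (Finset.ne_of_mem_erase hj)
        (hleaf j (Finset.mem_of_mem_erase hj)) hxy
    simp only [← Finset.mul_prod_erase S _ hi]
    rw [integral_adjMatrix_wRandomGraph_mul hdeg (hS i hi).symm
      (integrable_prod_adjMatrix (measurable_adjMatrix_wRandomGraph g) _ f) hrest,
      ih _ (Finset.erase_ssubset hi) fun j hj => hS j (Finset.mem_of_mem_erase hj), ← pow_succ',
      Finset.card_erase_add_one hi]

end WRandomGraph

theorem IsUniformSample.measurePreserving {Ω : Type*} [MeasurableSpace Ω] {P : Measure Ω}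
    [IsProbabilityMeasure P] {n : ℕ} {ξ : SampleIndex n → Ω → I} (hξ : IsUniformSample P ξ) :
    MeasurePreserving (fun ω a => ξ a ω) P volume := by
  refine ⟨measurable_pi_iff.2 hξ.measurable, ?_⟩
  rw [(iIndepFun_iff_map_fun_eq_pi_map fun a => (hξ.measurable a).aemeasurable).1 hξ.indep]
  simp only [hξ.uniform]
  rfl

open Classical in
theorem modifiedLaplacianDet_eq {n : ℕ} (G : SimpleGraph (Fin n)) (p : ℝ) (ε : Fin n → ℝ)
    (z : ℂ) :
    modifiedLaplacianDet G p ε z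
      = (Matrix.diagonal (fun i => 1 + ε i * z + p * z) + (-(z / n)) • G.lapMatrix ℂ).det := by
  have hdiagonal : Matrix.diagonal (fun i => 1 + ε i * z + p * z)
      = (1 + p * z) • (1 : Matrix (Fin n) (Fin n) ℂ)
        + z • Matrix.diagonal (fun i => (ε i : ℂ)) := by
    rw [Matrix.smul_one_eq_diagonal, ← Matrix.diagonal_smul, Matrix.diagonal_add]
    congr 1
    ext i
    simp only [Pi.smul_apply, smul_eq_mul]
    ring
  rw [modifiedLaplacianDet, graphLaplacian, hdiagonal, neg_smul, ← sub_eq_add_neg]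

theorem integrable_modifiedLaplacianDet_wRandomGraph (g : GraphFunction) (p : ℝ) {n : ℕ}
    (ε : Fin n → ℝ) (z : ℂ) :
    Integrable fun x => modifiedLaplacianDet (wRandomGraph g x) p ε z := by
  classical
  simp only [modifiedLaplacianDet_eq]
  exact integrable_det_diagonal_add_smul_lapMatrix (measurable_adjMatrix_wRandomGraph g) _ _

theorem integral_modifiedLaplacianDet_wRandomGraph {g : GraphFunction} {p : ℝ}
    (hdeg : ∀ᵐ y, g.degree y = p) {n : ℕ} (hn : n ≠ 0) (ε : Fin n → ℝ) (z : ℂ) :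
    ∫ x, modifiedLaplacianDet (wRandomGraph g x) p ε z
      = 1 / n * ∑ i, (1 + p * z + ε i * z) * ∏ j ∈ Finset.univ.erase i, (1 + ε j * z) := by
  classical
  have hcard : (Fintype.card (Fin n) : ℂ) ≠ 0 := by
    rw [Fintype.card_fin]
    exact Nat.cast_ne_zero.2 hn
  have hweight : -(z / n) * (p : ℂ) = -(p * z / Fintype.card (Fin n)) := by
    rw [Fintype.card_fin, neg_mul, mul_comm, mul_div_assoc]
  simp only [modifiedLaplacianDet_eq]
  rw [integral_det_diagonal_add_smul_lapMatrix (p := (p : ℂ))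
    (measurable_adjMatrix_wRandomGraph g) fun f hf =>
      integral_prod_adjMatrix_wRandomGraph hdeg hf fun i hi => (Finset.mem_filter.1 hi).2]
  simpa only [hweight, Fintype.card_fin, add_right_comm 1 ((p : ℂ) * z)] using
    det_diagonal_add_smul_lapMatrix_top_eq_average hcard (fun i => 1 + ε i * z) (p * z)

theorem mainTheorem8_general {g : GraphFunction} {p : ℝ} (hdeg : ∀ᵐ y, g.degree y = p)
    {Ω : Type*} [MeasurableSpace Ω] (P : Measure Ω) [IsProbabilityMeasure P]
    (n : ℕ) (hn : 1 ≤ n) (ξ : SampleIndex n → Ω → I) (hξ : IsUniformSample P ξ)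
    (ε : Fin n → ℝ) (z : ℂ) :
    Integrable (fun ω => modifiedLaplacianDet (wRandomGraph g (fun a => ξ a ω)) p ε z) P ∧
    (∫ ω, modifiedLaplacianDet (wRandomGraph g (fun a => ξ a ω)) p ε z ∂P
      = (1 / (n : ℂ)) * ∑ i, (1 + p * z + ε i * z) *
          ∏ j ∈ Finset.univ.erase i, (1 + ε j * z)) ∧
    ((∀ i, 1 + (ε i : ℂ) * z ≠ 0) →
      ∫ ω, modifiedLaplacianDet (wRandomGraph g (fun a => ξ a ω)) p ε z ∂P
        = (∏ i, (1 + ε i * z)) *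
          ((1 / (n : ℂ)) * ∑ i, (1 + p * z + ε i * z) / (1 + ε i * z))) := by
  have hsample := hξ.measurePreserving
  have hint := integrable_modifiedLaplacianDet_wRandomGraph g p ε z
  have htransport : ∫ ω, modifiedLaplacianDet (wRandomGraph g (fun a => ξ a ω)) p ε z ∂P
      = ∫ x, modifiedLaplacianDet (wRandomGraph g x) p ε z := by
    rw [← hsample.map_eq] at hint ⊢
    exact (integral_map hsample.aemeasurable hint.aestronglyMeasurable).symm
  rw [htransport, integral_modifiedLaplacianDet_wRandomGraph hdeg (Nat.one_le_iff_ne_zero.1 hn)]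
  refine ⟨hsample.integrable_comp_of_integrable hint, rfl, fun hε => ?_⟩
  rw [sum_mul_prod_erase hε, mul_left_comm]

theorem mainTheorem8 (γ : Graphon) (hγ : γ.IsSingular) (p : ℝ) (hp : γ.edgeDensity = p)
    (g : GraphFunction) (hg : Graphon.mk g = γ)
    {Ω : Type*} [MeasurableSpace Ω] (P : Measure Ω) [IsProbabilityMeasure P]
    (n : ℕ) (hn : 1 ≤ n) (ξ : SampleIndex n → Ω → I) (hξ : IsUniformSample P ξ)
    (ε : Fin n → ℝ) (z : ℂ) :
    Integrable (fun ω => modifiedLaplacianDet (wRandomGraph g (fun a => ξ a ω)) p ε z) P ∧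
    (∫ ω, modifiedLaplacianDet (wRandomGraph g (fun a => ξ a ω)) p ε z ∂P
      = (1 / (n : ℂ)) * ∑ i, (1 + p * z + ε i * z) *
          ∏ j ∈ Finset.univ.erase i, (1 + ε j * z)) ∧
    ((∀ i, 1 + (ε i : ℂ) * z ≠ 0) →
      ∫ ω, modifiedLaplacianDet (wRandomGraph g (fun a => ξ a ω)) p ε z ∂P
        = (∏ i, (1 + ε i * z)) *
          ((1 / (n : ℂ)) * ∑ i, (1 + p * z + ε i * z) / (1 + ε i * z))) :=
  mainTheorem8_general (hγ.ae_degree_eq hp hg) P n hn ξ hξ ε z
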